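/- Let $1\le k\le p$ be integers and let $$\widetilde{\mathcal A}_k^p=\Big\{a\in\mathbb R^p:\ \|a\|_0=k,\ |a_i|=\tfrac1{\sqrt k}\ \text{ for all } i\in\operatorname{supp}(a)\Big\}.$$ Let $\kappa_k$ be the norm on $\mathbb R^p$ whose unit ball is the convex hull of $\widetilde{\mathcal A}_k^p$, that is, the atomic norm $\kappa_k(x)=\inf\{t>0:\ x\in t\,\mathrm{conv}(\widetilde{\mathcal A}_k^p)\}$. For a convex function $\Omega:\mathbb R^p\to\mathbb R$ and $a\in\mathbb R^p$, let $$T_\Omega(a)=\overline{\bigcup_{\tau>0}\{h\in\mathbb R^p:\ \Omega(a+\tau h)\le\Omega(a)\}}$$ be the tangent cone of $\Omega$ at $a$, and let $\mathfrak S(a,\Omega)=\mathbb E\big[\|\Pi_{T_\Omega(a)}(G)\|_2^2\big]$ be the statistical dimension of $\Omega$ at $a$, where $G$ is a random vector in $\mathbb R^p$ with i.i.d. standard normal entries and $\Pi_{T_\Omega(a)}$ is the orthogonal projection onto the closed convex cone $T_\Omega(a)$. Then for every $a\in\widetilde{\mathcal A}_k^p$ the expectation defining $\mathfrak S(a,\kappa_k)$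 is finite and $$\frac{k}{2\pi}\log\Big(\frac{p-k}{k+1}\Big)\ \le\ \mathfrak S(a,\kappa_k)\ \le\ 9k\log\frac pk+16(k+1),$$ where $\log$ is the natural logarithm (for $p=k$ the lower bound is $-\infty$ and carries no information). -/

import Mathlib

open MeasureTheory ProbabilityTheory

noncomputable section

/-- The set `Ã_k^p` of vectors of `ℝ^p` with exactly `k` nonzero entries, all of which have
absolute value `1 / √k`. -/
def cutAtoms (k p : ℕ) : Set (EuclideanSpace ℝ (Fin p)) :=
  {a | {i | a i ≠ 0}.ncard = k ∧ ∀ i, a i ≠ 0 → |a i| = 1 / √(k : ℝ)}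

/-- The atomic norm induced by a set of atoms `A`: the gauge
`x ↦ inf {t > 0 | x ∈ t • conv A}` of its convex hull. -/
def atomicNorm {E : Type*} [AddCommGroup E] [Module ℝ E] (A : Set E) (x : E) : ℝ :=
  gauge (convexHull ℝ A) x

/-- The norm `κ_k` on `ℝ^p`: the atomic norm induced by `Ã_k^p`. -/
def kappaNorm (k p : ℕ) (x : EuclideanSpace ℝ (Fin p)) : ℝ :=
  atomicNorm (cutAtoms k p) x

/-- The tangent cone of `Ω` at `z`: the closure of the cone of descent directions,
`⋃_{τ > 0} {h | Ω (z + τ h) ≤ Ω z}`. -/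
def descentTangentCone {E : Type*} [NormedAddCommGroup E] [NormedSpace ℝ E]
    (Ω : E → ℝ) (z : E) : Set E :=
  closure (⋃ τ > (0 : ℝ), {h | Ω (z + τ • h) ≤ Ω z})

/-- The (orthogonal) projection of `x` onto `C`: the point of `C` closest to `x`. It exists and is
unique when `C` is a nonempty closed convex set of a Euclidean space, see `metricProj_spec` and
`eq_metricProj`. -/
def metricProj {E : Type*} [NormedAddCommGroup E] (C : Set E) (x : E) : E :=
  Classical.epsilon fun y => y ∈ C ∧ ∀ z ∈ C, ‖x - y‖ ≤ ‖x - z‖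

theorem metricProj_spec {E : Type*} [NormedAddCommGroup E] [InnerProductSpace ℝ E]
    [FiniteDimensional ℝ E] {C : Set E} (hne : C.Nonempty) (hcl : IsClosed C) (x : E) :
    metricProj C x ∈ C ∧ ∀ z ∈ C, ‖x - metricProj C x‖ ≤ ‖x - z‖ := by
  have h : ∃ y, y ∈ C ∧ ∀ z ∈ C, ‖x - y‖ ≤ ‖x - z‖ := by
    obtain ⟨y, hy, hxy⟩ := hcl.exists_infDist_eq_dist hne x
    refine ⟨y, hy, fun z hz => ?_⟩
    rw [← dist_eq_norm, ← dist_eq_norm, ← hxy]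
    exact Metric.infDist_le_dist_of_mem hz
  exact Classical.epsilon_spec h

theorem eq_metricProj {E : Type*} [NormedAddCommGroup E] [InnerProductSpace ℝ E]
    [FiniteDimensional ℝ E] {C : Set E} (hcl : IsClosed C) (hconv : Convex ℝ C) {x y : E}
    (hy : y ∈ C) (hmin : ∀ z ∈ C, ‖x - y‖ ≤ ‖x - z‖) : y = metricProj C x := by
  obtain ⟨hq, hqmin⟩ := metricProj_spec ⟨y, hy⟩ hcl x
  set q := metricProj C x
  have heq : ‖x - y‖ = ‖x - q‖ := le_antisymm (hmin q hq) (hqmin y hy)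
  have hm := hmin _ (hconv hy hq (a := 1 / 2) (b := 1 / 2) (by norm_num) (by norm_num)
    (by norm_num))
  have hpar := parallelogram_law_with_norm ℝ (x - y) (x - q)
  have e1 : x - y + (x - q) = (2 : ℝ) • (x - ((1 / 2 : ℝ) • y + (1 / 2 : ℝ) • q)) := by module
  have e2 : x - y - (x - q) = q - y := by abel
  rw [e1, e2, norm_smul, Real.norm_of_nonneg (by norm_num : (0 : ℝ) ≤ 2), ← heq] at hpar
  have h0 : ‖q - y‖ = 0 := by
    nlinarith [norm_nonneg (q - y), norm_nonneg (x - y), mul_self_le_mul_self (norm_nonneg _) hm]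
  exact (sub_eq_zero.mp (norm_eq_zero.mp h0)).symm

theorem zero_mem_descentTangentCone {E : Type*} [NormedAddCommGroup E] [NormedSpace ℝ E]
    (Ω : E → ℝ) (z : E) : (0 : E) ∈ descentTangentCone Ω z := by
  refine subset_closure (Set.mem_iUnion₂.mpr ⟨1, one_pos, ?_⟩)
  simp

theorem convex_descentTangentCone {E : Type*} [NormedAddCommGroup E] [NormedSpace ℝ E]
    {Ω : E → ℝ} (hΩ : ConvexOn ℝ Set.univ Ω) (z : E) : Convex ℝ (descentTangentCone Ω z) := by
  refine Convex.closure ?_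
  have shrink : ∀ {σ τ : ℝ} {h : E}, 0 < σ → σ ≤ τ → Ω (z + τ • h) ≤ Ω z →
      Ω (z + σ • h) ≤ Ω z := by
    intro σ τ h hσ hστ hh
    have hτ : 0 < τ := hσ.trans_le hστ
    have c₁ : 0 ≤ 1 - σ / τ := sub_nonneg.mpr ((div_le_one hτ).mpr hστ)
    have c₂ : 0 ≤ σ / τ := by positivity
    have h1 := hΩ.2 (Set.mem_univ z) (Set.mem_univ (z + τ • h)) c₁ c₂ (by ring)
    have e : (1 - σ / τ) • z + (σ / τ) • (z + τ • h) = z + σ • h := by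
      rw [smul_add, smul_smul, div_mul_cancel₀ _ hτ.ne']
      module
    rw [e] at h1
    simp only [smul_eq_mul] at h1
    nlinarith
  intro h₁ m₁ h₂ m₂ a b ha hb hab
  simp only [Set.mem_iUnion, Set.mem_ofPred_eq, exists_prop] at m₁ m₂ ⊢
  obtain ⟨τ₁, p₁, q₁⟩ := m₁
  obtain ⟨τ₂, p₂, q₂⟩ := m₂
  refine ⟨min τ₁ τ₂, lt_min p₁ p₂, ?_⟩
  have r₁ := shrink (lt_min p₁ p₂) (min_le_left _ _) q₁
  have r₂ := shrink (lt_min p₁ p₂) (min_le_right _ _) q₂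
  set τ := min τ₁ τ₂
  have h1 := hΩ.2 (Set.mem_univ (z + τ • h₁)) (Set.mem_univ (z + τ • h₂)) ha hb hab
  have e : a • (z + τ • h₁) + b • (z + τ • h₂) = z + τ • (a • h₁ + b • h₂) := by
    obtain rfl : b = 1 - a := by linarith
    module
  rw [e] at h1
  simp only [smul_eq_mul] at h1
  obtain rfl : b = 1 - a := by linarith
  nlinarith

/-- The statistical dimension `𝔖(z, Ω) = 𝔼 ‖Π_{T_Ω(z)}(G)‖²` of `Ω` at `z`, where `G` is a standard
Gaussian vector. -/
def statDim {E : Type*} [NormedAddCommGroup E] [InnerProductSpace ℝ E] [FiniteDimensional ℝ E]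
    [MeasurableSpace E] [BorelSpace E] (z : E) (Ω : E → ℝ) : ℝ :=
  ∫ g, ‖metricProj (descentTangentCone Ω z) g‖ ^ 2 ∂(stdGaussian E)

end

/-!
Every vector `y` minimising `⟪y, ·⟫` over the atoms at `a` is, up to sign, a normal vector at `a`,
and comparing `a` with the atoms obtained by moving or flipping one of its entries describes these
`y` explicitly through the sign pattern of `a`: the tangent cone is the dual of `signDualCone`.

Projecting onto a cone leaves at most the distance to any point of the polar cone. Clipping `g` at
level `±t` off the support and taking `t` times the sign pattern on it gives the upper bound, with
`t ^ 2 = 2 log (p / k) + 4`. Conversely `⟪g, h g⟫ ≤ ‖Π g‖ ‖h g‖` for every vector field `h` with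
values in the cone, so Cauchy–Schwarz bounds the statistical dimension below by
`𝔼 ⟪G, h G⟫ ^ 2 / 𝔼 ‖h G‖ ^ 2`. The field `h` with entries `sinh (t g_j)` off the support stays in
the cone once the support absorbs `∑ cosh (t g_j)`, its Gaussian moments are explicit, and
`t ^ 2 = log ((p - k) / (k + 1))` gives the lower bound.
-/

section ConeProjection

variable {E : Type*} [NormedAddCommGroup E] [InnerProductSpace ℝ E] [FiniteDimensional ℝ E]
  (C : ProperCone ℝ E)

theorem inner_metricProj (g : E) :
    inner ℝ g (metricProj (C : Set E) g) = ‖metricProj (C : Set E) g‖ ^ 2 := by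
  obtain ⟨hq, hmin⟩ := metricProj_spec C.nonempty C.isClosed g
  set q := metricProj (C : Set E) g
  have ray_min (c : ℝ) (hc : 0 ≤ c) :
      -2 * inner ℝ g q + ‖q‖ ^ 2 ≤ -2 * (c * inner ℝ g q) + c ^ 2 * ‖q‖ ^ 2 := by
    have h := pow_le_pow_left₀ (norm_nonneg _) (hmin _ (C.smul_mem hq hc)) 2
    rw [norm_sub_sq_real, norm_sub_sq_real, inner_smul_right, norm_smul, mul_pow,
      Real.norm_eq_abs, sq_abs] at h
    linarith
  rcases eq_or_ne q 0 with hq0 | hq0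
  · simp [hq0]
  have hpos : 0 < ‖q‖ ^ 2 := by positivity
  have hinner : 0 ≤ inner ℝ g q := by linarith [ray_min 0 le_rfl]
  have best := ray_min (inner ℝ g q / ‖q‖ ^ 2) (by positivity)
  have value : -2 * (inner ℝ g q / ‖q‖ ^ 2 * inner ℝ g q)
      + (inner ℝ g q / ‖q‖ ^ 2) ^ 2 * ‖q‖ ^ 2 = -(inner ℝ g q ^ 2 / ‖q‖ ^ 2) := by
    field_simp
    ring
  rw [value, le_neg, div_le_iff₀ hpos] at best
  nlinarith [sq_nonneg (inner ℝ g q - ‖q‖ ^ 2)]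

theorem norm_sq_metricProj (g : E) :
    ‖metricProj (C : Set E) g‖ ^ 2 = ‖g‖ ^ 2 - Metric.infDist g C ^ 2 := by
  have infDist_eq : Metric.infDist g C = ‖g - metricProj (C : Set E) g‖ := by
    obtain ⟨hq, hmin⟩ := metricProj_spec C.nonempty C.isClosed g
    refine le_antisymm ?_ ((Metric.le_infDist C.nonempty).2 fun {z} hz => ?_)
    · exact (Metric.infDist_le_dist_of_mem hq).trans_eq (dist_eq_norm _ _)
    · exact (hmin z hz).trans_eq (dist_eq_norm _ _).symm
  rw [infDist_eq, norm_sub_sq_real, inner_metricProj]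
  ring

theorem continuous_norm_sq_metricProj :
    Continuous fun g => ‖metricProj (C : Set E) g‖ ^ 2 := by
  simp_rw [norm_sq_metricProj]
  exact (continuous_norm.pow 2).sub ((Metric.continuous_infDist_pt _).pow 2)

variable {C}

theorem two_mul_inner_sub_norm_sq_le {h : E} (hh : h ∈ C) (g : E) :
    2 * inner ℝ g h - ‖h‖ ^ 2 ≤ ‖metricProj (C : Set E) g‖ ^ 2 := by
  have hdist := pow_le_pow_left₀ (norm_nonneg _)
    ((metricProj_spec C.nonempty C.isClosed g).2 h hh) 2
  rw [norm_sub_sq_real, norm_sub_sq_real, inner_metricProj] at hdist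
  linarith

theorem norm_sq_metricProj_innerDual_le {S : Set E} {y : E} (hy : y ∈ S) (g : E) :
    ‖metricProj (ProperCone.innerDual S : Set E) g‖ ^ 2 ≤ ‖g + y‖ ^ 2 := by
  set C := ProperCone.innerDual S
  have inner_nonneg : 0 ≤ inner ℝ y (metricProj (C : Set E) g) :=
    ProperCone.mem_innerDual.1 (metricProj_spec C.nonempty C.isClosed g).1 hy
  have hexpand := norm_sub_sq_real (g + y) (metricProj (C : Set E) g)
  rw [inner_add_left, inner_metricProj] at hexpand
  linarith [sq_nonneg ‖g + y - metricProj (C : Set E) g‖]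

variable [MeasurableSpace E] [BorelSpace E] {μ : Measure E}

theorem integrable_norm_sq_metricProj (hμ : MemLp id 2 μ) (C : ProperCone ℝ E) :
    Integrable (fun g => ‖metricProj (C : Set E) g‖ ^ 2) μ := by
  refine (hμ.integrable_norm_pow two_ne_zero).mono'
    (continuous_norm_sq_metricProj C).aestronglyMeasurable (.of_forall fun g => ?_)
  rw [Real.norm_of_nonneg (by positivity), norm_sq_metricProj]
  exact sub_le_self _ (sq_nonneg _)

theorem sq_integral_inner_le (hμ : MemLp id 2 μ) {h : E → E} (hC : ∀ g, h g ∈ C)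
    (hh : MemLp h 2 μ) (h_inner : 0 ≤ ∫ g, inner ℝ g (h g) ∂μ) :
    (∫ g, inner ℝ g (h g) ∂μ) ^ 2
      ≤ (∫ g, ‖metricProj (C : Set E) g‖ ^ 2 ∂μ) * ∫ g, ‖h g‖ ^ 2 ∂μ := by
  have int_inner : Integrable (fun g => inner ℝ g (h g)) μ :=
    (hμ.norm.integrable_mul hh.norm).mono' (hμ.1.inner hh.1)
      (.of_forall fun g => norm_inner_le_norm g (h g))
  have int_sq : Integrable (fun g => ‖h g‖ ^ 2) μ := hh.integrable_norm_pow two_ne_zero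
  set A := ∫ g, inner ℝ g (h g) ∂μ
  set B := ∫ g, ‖h g‖ ^ 2 ∂μ
  set D := ∫ g, ‖metricProj (C : Set E) g‖ ^ 2 ∂μ
  have scaled (c : ℝ) (hc : 0 ≤ c) : 2 * (c * A) - c ^ 2 * B ≤ D := by
    simp only [A, B, ← integral_const_mul]
    rw [← integral_sub ((int_inner.const_mul c).const_mul 2) (int_sq.const_mul _)]
    refine integral_mono (((int_inner.const_mul c).const_mul 2).sub (int_sq.const_mul _))
      (integrable_norm_sq_metricProj hμ C) fun g => ?_
    have hg := two_mul_inner_sub_norm_sq_le (C.smul_mem (hC g) hc) g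
    rwa [inner_smul_right, norm_smul, mul_pow, Real.norm_eq_abs, sq_abs] at hg
  have B_nonneg : 0 ≤ B := integral_nonneg fun g => by positivity
  have D_nonneg : 0 ≤ D := integral_nonneg fun g => by positivity
  have quadratic_nonneg (c : ℝ) : 0 ≤ B * (c * c) + -(2 * A) * c + D := by
    rcases le_total 0 c with hc | hc
    · linarith [scaled c hc]
    · linarith [mul_nonneg B_nonneg (mul_self_nonneg c), mul_nonneg h_inner (neg_nonneg.2 hc)]
  have := discrim_le_zero quadratic_nonneg
  rw [discrim] at this
  linarith

end ConeProjection

section DescentCone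

variable {E : Type*} [NormedAddCommGroup E] [NormedSpace ℝ E] {Ω : E → ℝ}

theorem smul_mem_descentTangentCone {z h : E} {c : ℝ} (hc : 0 ≤ c)
    (hh : h ∈ descentTangentCone Ω z) : c • h ∈ descentTangentCone Ω z := by
  rcases hc.eq_or_lt with rfl | hc
  · simpa using zero_mem_descentTangentCone Ω z
  refine map_mem_closure (continuous_const_smul c) hh fun x hx => ?_
  simp only [Set.mem_iUnion, Set.mem_ofPred_eq, exists_prop] at hx ⊢
  obtain ⟨τ, hτ, hx⟩ := hx
  refine ⟨τ / c, by positivity, ?_⟩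
  rwa [smul_smul, div_mul_cancel₀ _ hc.ne']

theorem sub_mem_descentTangentCone {z x : E} (hx : Ω x ≤ Ω z) :
    x - z ∈ descentTangentCone Ω z :=
  subset_closure (Set.mem_iUnion₂.2 ⟨1, one_pos, by simpa using hx⟩)

/-- The tangent cone `T_Ω(z)` of a convex function, as a bundled closed convex cone. -/
def descentProperCone (hΩ : ConvexOn ℝ Set.univ Ω) (z : E) : ProperCone ℝ E where
  carrier := descentTangentCone Ω z
  zero_mem' := zero_mem_descentTangentCone Ω z
  smul_mem' c _ hh := smul_mem_descentTangentCone c.2 hh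
  add_mem' {x y} hx hy := by
    have hmid : (1 / 2 : ℝ) • x + (1 / 2 : ℝ) • y ∈ descentTangentCone Ω z :=
      convex_descentTangentCone hΩ z hx hy (by norm_num) (by norm_num) (by norm_num)
    convert! smul_mem_descentTangentCone zero_le_two hmid using 1
    module
  isClosed' := isClosed_closure

end DescentCone

section AtomicNorm

theorem absorbent_convexHull {E : Type*} [AddCommGroup E] [Module ℝ E] {A : Set E}
    (hne : A.Nonempty) (hneg : ∀ b ∈ A, -b ∈ A) (hspan : Submodule.span ℝ A = ⊤) :
    Absorbent ℝ (convexHull ℝ A) := by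
  have hconv := convex_convexHull ℝ A
  have balanced : Balanced ℝ (convexHull ℝ A) := by
    refine (balanced_iff_neg_mem hconv).2 fun x hx => ?_
    rw [← Set.mem_neg, ← convexHull_neg]
    exact convexHull_mono hneg hx
  have zero_mem : (0 : E) ∈ convexHull ℝ A :=
    balanced.zero_mem (hne.mono (subset_convexHull ℝ A))
  have scale (a : ℝ) : Filter.Tendsto (a * ·) (nhds 0) (nhds 0) :=
    (continuous_const_mul a).tendsto' 0 0 (mul_zero a)
  have eventually_mem (x : E) : ∀ᶠ c : ℝ in nhds 0, c • x ∈ convexHull ℝ A := by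
    induction (hspan ▸ Submodule.mem_top : x ∈ Submodule.span ℝ A) using
      Submodule.span_induction with
    | zero => simp [zero_mem]
    | mem x hx =>
      filter_upwards [Metric.closedBall_mem_nhds (0 : ℝ) one_pos] with c hc
      exact balanced.smul_mem (by simpa using hc) (subset_convexHull ℝ A hx)
    | smul a x _ ih =>
      filter_upwards [(scale a).eventually ih] with c hc
      rwa [smul_smul, mul_comm]
    | add x y _ _ ihx ihy =>
      filter_upwards [(scale 2).eventually ihx, (scale 2).eventually ihy] with c hcx hcy
      convert! hconv hcx hcy one_half_pos.le one_half_pos.le (add_halves 1) using 1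
      module
  exact fun x => (absorbs_iff_eventually_nhds_zero zero_mem).2 (by simpa using eventually_mem x)

variable {E : Type*} [AddCommGroup E] [Module ℝ E] {A : Set E}

theorem convexOn_atomicNorm (hA : Absorbent ℝ (convexHull ℝ A)) :
    ConvexOn ℝ Set.univ (atomicNorm A) := by
  refine ⟨convex_univ, fun x _ y _ s t hs ht _ => ?_⟩
  refine (gauge_add_le (convex_convexHull ℝ A) hA _ _).trans_eq ?_
  rw [gauge_smul_of_nonneg hs, gauge_smul_of_nonneg ht]
  rfl

theorem atomicNorm_le_one_of_mem {x : E} (hx : x ∈ A) : atomicNorm A x ≤ 1 :=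
  gauge_le_one_of_mem (subset_convexHull ℝ A hx)

theorem map_le_mul_of_atomicNorm_le (hA : Absorbent ℝ (convexHull ℝ A)) (f : E →ₗ[ℝ] ℝ) {M : ℝ}
    (hf : ∀ b ∈ A, f b ≤ M) {x : E} {r : ℝ} (hx : atomicNorm A x ≤ r) : f x ≤ M * r := by
  have hull_le {y : E} (hy : y ∈ convexHull ℝ A) : f y ≤ M :=
    convexHull_min hf (convex_halfSpace_le f.isLinear M) hy
  have M_nonneg : 0 ≤ M := (map_zero f).ge.trans (hull_le hA.zero_mem)
  have le_of_gt (r' : ℝ) (hr' : r < r') : f x ≤ M * r' := by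
    obtain ⟨s, hs, hsr, y, hy, rfl⟩ := exists_lt_of_gauge_lt hA (hx.trans_lt hr')
    calc f (s • y) = s * f y := by simp
      _ ≤ s * M := by gcongr; exact hull_le hy
      _ ≤ M * r' := by rw [mul_comm]; gcongr
  have hlim : Filter.Tendsto (M * ·) (nhdsWithin r (Set.Ioi r)) (nhds (M * r)) :=
    (continuous_const_mul M).continuousWithinAt
  exact ge_of_tendsto hlim (Filter.eventually_of_mem self_mem_nhdsWithin le_of_gt)

end AtomicNorm

section AtomicDuality

variable {E : Type*} [NormedAddCommGroup E] [InnerProductSpace ℝ E] {A : Set E} {a : E}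

theorem atomicNorm_eq_one (hA : Absorbent ℝ (convexHull ℝ A)) (hnorm : ∀ b ∈ A, ‖b‖ = 1)
    (ha : a ∈ A) : atomicNorm A a = 1 := by
  refine (atomicNorm_le_one_of_mem ha).antisymm ?_
  have inner_le (b : E) (hb : b ∈ A) : innerₗ E a b ≤ 1 := by
    simpa [hnorm a ha, hnorm b hb] using real_inner_le_norm a b
  simpa [hnorm a ha] using
    map_le_mul_of_atomicNorm_le hA (innerₗ E a) inner_le (le_refl (atomicNorm A a))

theorem inner_nonneg_of_mem_descentTangentCone (hA : Absorbent ℝ (convexHull ℝ A))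
    (ha : atomicNorm A a = 1) {y h : E} (hy : ∀ b ∈ A, inner ℝ y a ≤ inner ℝ y b)
    (hh : h ∈ descentTangentCone (atomicNorm A) a) : 0 ≤ inner ℝ y h := by
  suffices descentTangentCone (atomicNorm A) a ⊆ {h | 0 ≤ inner ℝ y h} from this hh
  refine closure_minimal ?_ (isClosed_le continuous_const (innerSL ℝ y).continuous)
  refine Set.iUnion₂_subset fun τ hτ h hdescent => ?_
  have hbound : -innerₗ E y (a + τ • h) ≤ -innerₗ E y a * 1 :=
    map_le_mul_of_atomicNorm_le hA (-innerₗ E y) (by simpa using hy)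
      (hdescent.trans_eq ha)
  have : 0 ≤ τ * inner ℝ y h := by simpa [inner_add_right, inner_smul_right] using hbound
  exact nonneg_of_mul_nonneg_right this hτ

theorem descentProperCone_atomicNorm [CompleteSpace E] (hA : Absorbent ℝ (convexHull ℝ A))
    (hnorm : ∀ b ∈ A, ‖b‖ = 1) (ha : a ∈ A) :
    descentProperCone (convexOn_atomicNorm hA) a
      = ProperCone.innerDual {y | ∀ b ∈ A, inner ℝ y a ≤ inner ℝ y b} := by
  have ha_one := atomicNorm_eq_one hA hnorm ha
  refine le_antisymm (fun h hh => ProperCone.mem_innerDual.2 fun y hy =>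
    inner_nonneg_of_mem_descentTangentCone hA ha_one hy hh) ?_
  rw [← ProperCone.innerDual_innerDual (descentProperCone (convexOn_atomicNorm hA) a)]
  refine ProperCone.innerDual_le_innerDual fun y hy b hb => ?_
  have hsub : b - a ∈ descentTangentCone (atomicNorm A) a :=
    sub_mem_descentTangentCone ((atomicNorm_le_one_of_mem hb).trans_eq ha_one.symm)
  rw [← sub_nonneg, ← inner_sub_right, real_inner_comm]
  exact ProperCone.mem_innerDual.1 hy hsub

end AtomicDuality

section CutAtoms

open scoped Finset

variable {k p : ℕ} {a b y : EuclideanSpace ℝ (Fin p)}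

theorem card_support_of_mem_cutAtoms (ha : a ∈ cutAtoms k p) :
    #{i | a i ≠ 0} = k := by
  rw [← ha.1, Set.ncard_eq_toFinset_card', Set.toFinset_ofPred]

theorem abs_le_of_mem_cutAtoms (ha : a ∈ cutAtoms k p) (i : Fin p) : |a i| ≤ 1 / √(k : ℝ) := by
  by_cases h : a i = 0
  · rw [h, abs_zero]
    positivity
  · exact (ha.2 i h).le

theorem sum_abs_of_mem_cutAtoms (ha : a ∈ cutAtoms k p) : ∑ i, |a i| = √(k : ℝ) := by
  calc ∑ i, |a i| = ∑ i with a i ≠ 0, |a i| :=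
        (Finset.sum_filter_of_ne fun i _ hi => abs_ne_zero.1 hi).symm
    _ = ∑ i with a i ≠ 0, 1 / √(k : ℝ) :=
        Finset.sum_congr rfl fun i hi => ha.2 i (Finset.mem_filter.1 hi).2
    _ = √(k : ℝ) := by
        rw [Finset.sum_const, card_support_of_mem_cutAtoms ha, nsmul_eq_mul, mul_one_div,
          Real.div_sqrt]

theorem norm_of_mem_cutAtoms (hk : k ≠ 0) (ha : a ∈ cutAtoms k p) : ‖a‖ = 1 := by
  have sq_eq (i : Fin p) : a i ^ 2 = |a i| * (1 / √(k : ℝ)) := by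
    by_cases h : a i = 0
    · simp [h]
    · rw [← sq_abs, sq, ha.2 i h]
  have : √(k : ℝ) ≠ 0 := by positivity
  rw [← sq_eq_sq₀ (norm_nonneg a) zero_le_one, EuclideanSpace.real_norm_sq_eq]
  simp_rw [sq_eq]
  rw [← Finset.sum_mul, sum_abs_of_mem_cutAtoms ha, mul_one_div_cancel this, one_pow]

theorem exists_ne_zero_of_mem_cutAtoms (hk : k ≠ 0) (ha : a ∈ cutAtoms k p) : ∃ i, a i ≠ 0 :=
  Set.nonempty_of_ncard_ne_zero (ha.1.trans_ne hk)

theorem mem_cutAtoms_of_abs_comp_perm (ha : a ∈ cutAtoms k p) (π : Equiv.Perm (Fin p))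
    (hb : ∀ i, |b i| = |a (π i)|) : b ∈ cutAtoms k p := by
  have ne_zero_iff (i : Fin p) : b i ≠ 0 ↔ a (π i) ≠ 0 := by
    rw [← abs_ne_zero, hb, abs_ne_zero]
  refine ⟨?_, fun i hi => (hb i).trans (ha.2 _ ((ne_zero_iff i).1 hi))⟩
  simp only [ne_zero_iff]
  exact (Set.ncard_preimage_of_injective_subset_range π.injective (by simp)).trans ha.1

theorem neg_mem_cutAtoms (ha : a ∈ cutAtoms k p) : -a ∈ cutAtoms k p :=
  mem_cutAtoms_of_abs_comp_perm ha 1 fun i => by simp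

theorem add_single_sub_single_mem_cutAtoms (ha : a ∈ cutAtoms k p) {i j : Fin p} {v : ℝ}
    (hij : j = i ∨ a j = 0) (hv : |v| = |a i|) :
    a + EuclideanSpace.single j v - EuclideanSpace.single i (a i) ∈ cutAtoms k p := by
  refine mem_cutAtoms_of_abs_comp_perm ha (Equiv.swap i j) fun l => ?_
  rcases hij with rfl | hj
  · by_cases hl : l = j <;> simp [hl, hv]
  rcases eq_or_ne l j with rfl | hlj
  · by_cases hl : l = i <;> simp [hl, hv, hj]
  rcases eq_or_ne l i with rfl | hli
  · simp [hlj, hj]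
  · simp [hli, hlj, Equiv.swap_apply_of_ne_of_ne]

theorem mul_le_neg_abs_mul_abs_of_inner_le (ha : a ∈ cutAtoms k p)
    (hy : ∀ b ∈ cutAtoms k p, inner ℝ y a ≤ inner ℝ y b) {i j : Fin p}
    (hij : j = i ∨ a j = 0) : a i * y i ≤ -(|a i| * |y j|) := by
  have key {v : ℝ} (hv : |v| = |a i|) : a i * y i ≤ v * y j := by
    have h := hy _ (add_single_sub_single_mem_cutAtoms ha hij hv)
    rw [inner_sub_right, inner_add_right, EuclideanSpace.inner_single_right,
      EuclideanSpace.inner_single_right] at h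
    simp only [conj_trivial] at h
    linarith
  rcases abs_cases (y j) with ⟨h, -⟩ | ⟨h, -⟩
  · simpa [h] using key (v := -|a i|) (by simp)
  · simpa [h] using key (v := |a i|) (by simp)

theorem span_cutAtoms (hk : k ≠ 0) (ha : a ∈ cutAtoms k p) :
    Submodule.span ℝ (cutAtoms k p) = ⊤ := by
  obtain ⟨i, hi⟩ := exists_ne_zero_of_mem_cutAtoms hk ha
  rw [← Submodule.orthogonal_eq_bot_iff, Submodule.eq_bot_iff]
  intro y hy
  have inner_eq (b) (hb : b ∈ cutAtoms k p) : inner ℝ y b = 0 :=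
    (Submodule.mem_orthogonal' _ _).1 hy b (Submodule.subset_span hb)
  have move {i j : Fin p} (hij : j = i ∨ a j = 0) (hi : a i ≠ 0) : y j = 0 := by
    have h₁ := mul_le_neg_abs_mul_abs_of_inner_le (y := y) ha
      (fun b hb => by rw [inner_eq a ha, inner_eq b hb]) hij
    have h₂ := mul_le_neg_abs_mul_abs_of_inner_le (y := -y) ha
      (fun b hb => by rw [inner_neg_left, inner_neg_left, inner_eq a ha, inner_eq b hb]) hij
    simp only [PiLp.neg_apply, mul_neg, abs_neg] at h₂
    have : 0 < |a i| := abs_pos.2 hi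
    exact abs_nonpos_iff.1 (nonpos_of_mul_nonpos_right (by linarith) this)
  ext j
  by_cases hj : a j = 0
  exacts [move (.inr hj) hi, move (.inl rfl) hj]

theorem absorbent_convexHull_cutAtoms (hk : k ≠ 0) (ha : a ∈ cutAtoms k p) :
    Absorbent ℝ (convexHull ℝ (cutAtoms k p)) :=
  absorbent_convexHull ⟨a, ha⟩ (fun _ => neg_mem_cutAtoms) (span_cutAtoms hk ha)

end CutAtoms

/-- For a sign pattern `σ` on the coordinates, the vectors `y` that are bounded by some `t ≥ 0` off
the support of `σ` and point against `σ`, with entries of absolute value at least `t`, on it. For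
`σ` the sign pattern of `a ∈ cutAtoms k p` this is the dual cone of the tangent cone of
`kappaNorm k p` at `a`, the negative of its normal cone. -/
def signDualCone {ι : Type*} (σ : ι → SignType) : Set (EuclideanSpace ℝ ι) :=
  {y | ∃ t : ℝ, 0 ≤ t ∧ (∀ i, σ i = 0 → |y i| ≤ t) ∧ ∀ i, σ i ≠ 0 → σ i * y i ≤ -t}

theorem abs_signType_cast {s : SignType} (hs : s ≠ 0) : |(s : ℝ)| = 1 := by
  cases s <;> simp at hs ⊢

section CutAtomsDuality

variable {k p : ℕ} {a b y : EuclideanSpace ℝ (Fin p)}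

theorem mem_signDualCone_of_inner_le (hk : k ≠ 0) (ha : a ∈ cutAtoms k p)
    (hy : ∀ b ∈ cutAtoms k p, inner ℝ y a ≤ inner ℝ y b) :
    y ∈ signDualCone fun i => .sign (a i) := by
  have sign_mul_le {i j : Fin p} (hi : a i ≠ 0) (hij : j = i ∨ a j = 0) :
      SignType.sign (a i) * y i ≤ -|y j| := by
    have h := mul_le_neg_abs_mul_abs_of_inner_le ha hy hij
    nth_rw 1 [← abs_mul_sign (a i)] at h
    rw [mul_assoc, ← mul_neg] at h
    exact le_of_mul_le_mul_left h (abs_pos.2 hi)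
  obtain ⟨i₀, hi₀⟩ := exists_ne_zero_of_mem_cutAtoms hk ha
  obtain ⟨m, hm, hmin⟩ := (Finset.univ.filter (a · ≠ 0)).exists_min_image
    (fun i => -(SignType.sign (a i) * y i)) ⟨i₀, by simpa using hi₀⟩
  replace hm : a m ≠ 0 := by simpa using hm
  refine ⟨-(SignType.sign (a m) * y m), ?_, fun j hj => ?_, fun i hi => ?_⟩
  · linarith [sign_mul_le hm (.inl rfl), abs_nonneg (y m)]
  · linarith [sign_mul_le hm (.inr (sign_eq_zero_iff.1 hj))]
  · linarith [hmin i (by simpa using hi)]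

theorem inner_le_of_mem_signDualCone (ha : a ∈ cutAtoms k p)
    (hy : y ∈ signDualCone fun i => .sign (a i)) (hb : b ∈ cutAtoms k p) :
    inner ℝ y a ≤ inner ℝ y b := by
  obtain ⟨t, ht, h_off, h_on⟩ := hy
  have coordinate_le (i : Fin p) : t * |a i| - t * |b i| ≤ b i * y i - a i * y i := by
    have hby : -(|b i| * |y i|) ≤ b i * y i := by
      rw [← abs_mul]
      exact neg_abs_le _
    by_cases hi : a i = 0
    · have := mul_le_mul_of_nonneg_left (h_off i (sign_eq_zero_iff.2 hi)) (abs_nonneg (b i))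
      simp only [hi, abs_zero]
      linarith
    · have hσy := h_on i (sign_ne_zero.2 hi)
      have hy : |y i| = -(SignType.sign (a i) * y i) := by
        rw [← abs_of_nonpos (by linarith), abs_mul, abs_signType_cast (sign_ne_zero.2 hi), one_mul]
      have hay : a i * y i = -(|a i| * |y i|) := by
        rw [hy, mul_neg, neg_neg, ← mul_assoc, abs_mul_sign]
      have hba : |b i| ≤ |a i| := (abs_le_of_mem_cutAtoms hb i).trans_eq (ha.2 i hi).symm
      nlinarith
  have sum_le := Finset.sum_le_sum fun i (_ : i ∈ Finset.univ) => coordinate_le i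
  simp only [Finset.sum_sub_distrib, ← Finset.mul_sum, sum_abs_of_mem_cutAtoms ha,
    sum_abs_of_mem_cutAtoms hb, sub_self, sub_nonneg] at sum_le
  simpa [PiLp.inner_apply] using sum_le

theorem descentTangentCone_kappaNorm (hk : k ≠ 0) (ha : a ∈ cutAtoms k p) :
    descentTangentCone (kappaNorm k p) a =
      ProperCone.innerDual (signDualCone fun i => .sign (a i)) := by
  have dual_eq : {y | ∀ b ∈ cutAtoms k p, inner ℝ y a ≤ inner ℝ y b}
      = signDualCone fun i => .sign (a i) :=
    Set.ext fun y => ⟨mem_signDualCone_of_inner_le hk ha,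
      fun hy _ => inner_le_of_mem_signDualCone ha hy⟩
  rw [← dual_eq, ← descentProperCone_atomicNorm
    (absorbent_convexHull_cutAtoms hk ha) (fun _ => norm_of_mem_cutAtoms hk) ha]
  rfl

end CutAtomsDuality

section ScalarGaussian

theorem memLp_two_exp_mul_gaussianReal (t : ℝ) :
    MemLp (fun x => Real.exp (t * x)) 2 (gaussianReal 0 1) := by
  refine (memLp_two_iff_integrable_sq (by fun_prop)).2 ?_
  simp_rw [← Real.exp_nat_mul, Nat.cast_ofNat, ← mul_assoc]
  exact integrable_exp_mul_gaussianReal _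

theorem memLp_two_cosh_mul_gaussianReal (t : ℝ) :
    MemLp (fun x => Real.cosh (t * x)) 2 (gaussianReal 0 1) := by
  have h := ((memLp_two_exp_mul_gaussianReal t).add
    (memLp_two_exp_mul_gaussianReal (-t))).mul_const 2⁻¹
  simpa only [Pi.add_apply, Real.cosh_eq, div_eq_mul_inv, neg_mul] using h

theorem memLp_two_sinh_mul_gaussianReal (t : ℝ) :
    MemLp (fun x => Real.sinh (t * x)) 2 (gaussianReal 0 1) := by
  have h := ((memLp_two_exp_mul_gaussianReal t).sub
    (memLp_two_exp_mul_gaussianReal (-t))).mul_const 2⁻¹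
  simpa only [Pi.sub_apply, Real.sinh_eq, div_eq_mul_inv, neg_mul] using h

theorem integrable_cosh_mul_gaussianReal (t : ℝ) :
    Integrable (fun x => Real.cosh (t * x)) (gaussianReal 0 1) :=
  (memLp_two_cosh_mul_gaussianReal t).integrable one_le_two

theorem integral_exp_mul_gaussianReal (t : ℝ) :
    ∫ x, Real.exp (t * x) ∂gaussianReal 0 1 = Real.exp (t ^ 2 / 2) := by
  simpa [mgf] using congrFun (mgf_fun_id_gaussianReal (μ := 0) (v := 1)) t

theorem integral_cosh_mul_gaussianReal (t : ℝ) :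
    ∫ x, Real.cosh (t * x) ∂gaussianReal 0 1 = Real.exp (t ^ 2 / 2) := by
  simp_rw [Real.cosh_eq, ← neg_mul]
  rw [integral_div, integral_add (integrable_exp_mul_gaussianReal t)
    (integrable_exp_mul_gaussianReal (-t)), integral_exp_mul_gaussianReal,
    integral_exp_mul_gaussianReal, neg_sq, add_self_div_two]

theorem integral_cosh_mul_sq_gaussianReal (t : ℝ) :
    ∫ x, Real.cosh (t * x) ^ 2 ∂gaussianReal 0 1 = (Real.exp (2 * t ^ 2) + 1) / 2 := by
  have half_angle (x : ℝ) : Real.cosh (t * x) ^ 2 = (Real.cosh (2 * t * x) + 1) / 2 := by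
    rw [mul_assoc, Real.cosh_two_mul, Real.sinh_sq]
    ring
  simp_rw [half_angle]
  rw [integral_div, integral_add (integrable_cosh_mul_gaussianReal _) (integrable_const 1),
    integral_cosh_mul_gaussianReal, integral_const, probReal_univ, one_smul]
  ring_nf

theorem integral_sinh_mul_sq_gaussianReal (t : ℝ) :
    ∫ x, Real.sinh (t * x) ^ 2 ∂gaussianReal 0 1 = (Real.exp (2 * t ^ 2) - 1) / 2 := by
  simp_rw [Real.sinh_sq]
  rw [integral_sub (memLp_two_cosh_mul_gaussianReal t).integrable_sq (integrable_const 1),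
    integral_cosh_mul_sq_gaussianReal, integral_const, probReal_univ, one_smul]
  ring

theorem variance_cosh_mul_gaussianReal (t : ℝ) :
    Var[fun x => Real.cosh (t * x); gaussianReal 0 1] = (Real.exp (t ^ 2) - 1) ^ 2 / 2 := by
  rw [variance_eq_sub (memLp_two_cosh_mul_gaussianReal t)]
  simp only [Pi.pow_apply]
  rw [integral_cosh_mul_sq_gaussianReal, integral_cosh_mul_gaussianReal, ← Real.exp_nat_mul,
    Nat.cast_ofNat, mul_div_cancel₀ _ two_ne_zero, mul_comm (2 : ℝ), Real.exp_mul]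
  norm_cast
  ring

theorem integral_mul_exp_mul_gaussianReal (t : ℝ) :
    ∫ x, x * Real.exp (t * x) ∂gaussianReal 0 1 = t * Real.exp (t ^ 2 / 2) := by
  have t_mem : t ∈ interior (integrableExpSet (fun x : ℝ => x) (gaussianReal 0 1)) := by simp
  have mgf_eq : mgf (fun x : ℝ => x) (gaussianReal 0 1) = fun t => Real.exp (t ^ 2 / 2) :=
    funext fun t => integral_exp_mul_gaussianReal t
  have hderiv : HasDerivAt (fun t : ℝ => Real.exp (t ^ 2 / 2)) (Real.exp (t ^ 2 / 2) * t) t := by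
    simpa using (((hasDerivAt_id t).pow 2).div_const 2).exp
  rw [← deriv_mgf t_mem, mgf_eq, hderiv.deriv, mul_comm]

theorem memLp_two_id_gaussianReal : MemLp (fun x : ℝ => x) 2 (gaussianReal 0 1) :=
  IsGaussian.memLp_two_id

theorem integral_mul_sinh_mul_gaussianReal (t : ℝ) :
    ∫ x, x * Real.sinh (t * x) ∂gaussianReal 0 1 = t * Real.exp (t ^ 2 / 2) := by
  have integrable_mul_exp (t : ℝ) :
      Integrable (fun x => x * Real.exp (t * x)) (gaussianReal 0 1) :=
    memLp_two_id_gaussianReal.integrable_mul (memLp_two_exp_mul_gaussianReal t)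
  simp_rw [Real.sinh_eq, ← neg_mul, mul_div_assoc', mul_sub]
  rw [integral_div, integral_sub (integrable_mul_exp t) (integrable_mul_exp (-t)),
    integral_mul_exp_mul_gaussianReal, integral_mul_exp_mul_gaussianReal]
  ring_nf

theorem integral_sub_sq_gaussianReal (s : ℝ) :
    ∫ x, (x - s) ^ 2 ∂gaussianReal 0 1 = 1 + s ^ 2 := by
  have int_id : Integrable (fun x : ℝ => x) (gaussianReal 0 1) :=
    memLp_two_id_gaussianReal.integrable one_le_two
  have h := variance_eq_sub (memLp_two_id_gaussianReal.sub (memLp_const s))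
  change Var[fun x => x - s; gaussianReal 0 1] = ∫ x, (x - s) ^ 2 ∂gaussianReal 0 1
    - (∫ x, x - s ∂gaussianReal 0 1) ^ 2 at h
  rw [variance_sub_const (by fun_prop), variance_fun_id_gaussianReal,
    integral_sub int_id (integrable_const s), integral_id_gaussianReal] at h
  simp only [NNReal.coe_one, integral_const, probReal_univ, one_smul, zero_sub, neg_sq] at h
  linarith

end ScalarGaussian

section StdGaussian

variable {ι : Type*} [Fintype ι]

theorem measurePreserving_eval_stdGaussian (i : ι) :
    MeasurePreserving (fun g : EuclideanSpace ℝ ι => g i)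
      (stdGaussian (EuclideanSpace ℝ ι)) (gaussianReal 0 1) := by
  refine ⟨by fun_prop, ?_⟩
  rw [← map_pi_eq_stdGaussian, Measure.map_map (by fun_prop) (by fun_prop)]
  exact (measurePreserving_eval (fun _ : ι => gaussianReal 0 1) i).map_eq

theorem iIndepFun_eval_stdGaussian :
    iIndepFun (fun (i : ι) (g : EuclideanSpace ℝ ι) => g i) (stdGaussian (EuclideanSpace ℝ ι)) := by
  rw [iIndepFun_iff_map_fun_eq_pi_map fun i => by fun_prop]
  simp_rw [(measurePreserving_eval_stdGaussian _).map_eq]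
  rw [← map_pi_eq_stdGaussian, Measure.map_map (by fun_prop) (by fun_prop)]
  exact Measure.map_id

theorem integral_comp_eval_stdGaussian {f : ℝ → ℝ}
    (hf : AEStronglyMeasurable f (gaussianReal 0 1)) (i : ι) :
    ∫ g, f (g i) ∂stdGaussian (EuclideanSpace ℝ ι) = ∫ x, f x ∂gaussianReal 0 1 := by
  have heval := measurePreserving_eval_stdGaussian i
  rw [← heval.map_eq, integral_map heval.measurable.aemeasurable (heval.map_eq ▸ hf)]

variable {f : ℝ → ℝ} (s : Finset ι)

theorem integrable_comp_eval_stdGaussian (hf : Integrable f (gaussianReal 0 1)) (i : ι) :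
    Integrable (fun g : EuclideanSpace ℝ ι => f (g i)) (stdGaussian (EuclideanSpace ℝ ι)) :=
  (measurePreserving_eval_stdGaussian i).integrable_comp_of_integrable hf

theorem memLp_comp_eval_stdGaussian (hf : MemLp f 2 (gaussianReal 0 1)) (i : ι) :
    MemLp (fun g : EuclideanSpace ℝ ι => f (g i)) 2 (stdGaussian (EuclideanSpace ℝ ι)) :=
  hf.comp_measurePreserving (measurePreserving_eval_stdGaussian i)

theorem integral_sum_comp_eval_stdGaussian (hf : Integrable f (gaussianReal 0 1)) :
    ∫ g, ∑ i ∈ s, f (g i) ∂stdGaussian (EuclideanSpace ℝ ι)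
      = s.card * ∫ x, f x ∂gaussianReal 0 1 := by
  rw [integral_finsetSum s fun i _ => integrable_comp_eval_stdGaussian hf i]
  simp [integral_comp_eval_stdGaussian hf.1]

theorem indepFun_comp_eval_stdGaussian {f f' : ℝ → ℝ} (hf : AEMeasurable f (gaussianReal 0 1))
    (hf' : AEMeasurable f' (gaussianReal 0 1)) {i j : ι} (hij : i ≠ j) :
    IndepFun (fun g => f (g i)) (fun g => f' (g j)) (stdGaussian (EuclideanSpace ℝ ι)) :=
  (iIndepFun_eval_stdGaussian.indepFun hij).comp₀
    (measurePreserving_eval_stdGaussian i).measurable.aemeasurable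
    (measurePreserving_eval_stdGaussian j).measurable.aemeasurable
    ((measurePreserving_eval_stdGaussian i).map_eq ▸ hf)
    ((measurePreserving_eval_stdGaussian j).map_eq ▸ hf')

theorem integral_sq_sum_comp_eval_stdGaussian (hf : MemLp f 2 (gaussianReal 0 1)) :
    ∫ g, (∑ i ∈ s, f (g i)) ^ 2 ∂stdGaussian (EuclideanSpace ℝ ι)
      = s.card * Var[f; gaussianReal 0 1] + (s.card * ∫ x, f x ∂gaussianReal 0 1) ^ 2 := by
  have memLp_eval := memLp_comp_eval_stdGaussian (ι := ι) hf
  have variance_eval (i : ι) : Var[fun g : EuclideanSpace ℝ ι => f (g i);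
      stdGaussian (EuclideanSpace ℝ ι)] = Var[f; gaussianReal 0 1] :=
    (measurePreserving_eval_stdGaussian i).variance_fun_comp hf.1.aemeasurable
  have variance_sum := IndepFun.variance_sum (s := s) (fun i _ => memLp_eval i)
    fun i _ j _ hij => indepFun_comp_eval_stdGaussian hf.1.aemeasurable hf.1.aemeasurable hij
  rw [variance_eq_sub (memLp_finsetSum' s fun i _ => memLp_eval i)] at variance_sum
  simp only [Pi.pow_apply, Finset.sum_apply, variance_eval, Finset.sum_const, nsmul_eq_mul,
    integral_sum_comp_eval_stdGaussian s (hf.integrable one_le_two)] at variance_sum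
  linarith

theorem integral_mul_sum_comp_eval_stdGaussian (hf : MemLp f 2 (gaussianReal 0 1)) {i : ι}
    (hi : i ∉ s) : ∫ g, g i * ∑ j ∈ s, f (g j) ∂stdGaussian (EuclideanSpace ℝ ι) = 0 := by
  have integrable_mul (j : ι) : Integrable (fun g : EuclideanSpace ℝ ι => g i * f (g j))
      (stdGaussian (EuclideanSpace ℝ ι)) :=
    (memLp_comp_eval_stdGaussian memLp_two_id_gaussianReal i).integrable_mul
      (memLp_comp_eval_stdGaussian hf j)
  have eval_mean : ∫ g, g i ∂stdGaussian (EuclideanSpace ℝ ι) = 0 :=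
    (integral_comp_eval_stdGaussian aestronglyMeasurable_id i).trans integral_id_gaussianReal
  simp_rw [Finset.mul_sum]
  rw [integral_finsetSum s fun j _ => integrable_mul j]
  refine Finset.sum_eq_zero fun j hj => ?_
  have hij : i ≠ j := (ne_of_mem_of_not_mem hj hi).symm
  have indep := indepFun_comp_eval_stdGaussian (f := fun x => x) (by fun_prop)
    hf.1.aemeasurable hij
  rw [indep.integral_fun_mul_eq_mul_integral (by fun_prop) (memLp_comp_eval_stdGaussian hf j).1,
    eval_mean, zero_mul]

end StdGaussian

section UpperBound

open scoped Finset

theorem sq_sub_le_cosh {t x : ℝ} (ht : 0 < t) (hx : t ≤ x) :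
    (x - t) ^ 2 ≤ 4 / t ^ 2 * Real.exp (-t ^ 2) * Real.cosh (t * x) := by
  have hz : 0 ≤ t * (x - t) := mul_nonneg ht.le (sub_nonneg.2 hx)
  have exp_eq : Real.exp (t * (x - t)) = Real.exp (-t ^ 2) * Real.exp (t * x) := by
    rw [← Real.exp_add]
    ring_nf
  have exp_le : Real.exp (t * x) ≤ 2 * Real.cosh (t * x) := by
    rw [Real.cosh_eq]
    linarith [Real.exp_pos (-(t * x))]
  have sq_le : (t * (x - t)) ^ 2 ≤ 4 * (Real.exp (-t ^ 2) * Real.cosh (t * x)) := by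
    nlinarith [Real.quadratic_le_exp_of_nonneg hz, Real.exp_pos (-t ^ 2)]
  calc (x - t) ^ 2 = (t * (x - t)) ^ 2 / t ^ 2 := by field_simp
    _ ≤ 4 * (Real.exp (-t ^ 2) * Real.cosh (t * x)) / t ^ 2 := by gcongr
    _ = _ := by ring

theorem sq_sub_clip_le_cosh {t : ℝ} (ht : 0 < t) (x : ℝ) :
    (x - max (-t) (min x t)) ^ 2 ≤ 4 / t ^ 2 * Real.exp (-t ^ 2) * Real.cosh (t * x) := by
  rcases le_total t x with h | h
  · rw [min_eq_right h, max_eq_right (by linarith)]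
    exact sq_sub_le_cosh ht h
  rw [min_eq_left h]
  rcases le_total x (-t) with h' | h'
  · rw [max_eq_left h']
    have := sq_sub_le_cosh ht (x := -x) (by linarith)
    rw [mul_neg, Real.cosh_neg] at this
    linarith
  · have := Real.cosh_pos (t * x)
    rw [max_eq_right h', sub_self, zero_pow two_ne_zero]
    positivity

variable {ι : Type*} [Fintype ι] (σ : ι → SignType) {t : ℝ}

theorem norm_sq_metricProj_innerDual_signDualCone_le (ht : 0 < t) (g : EuclideanSpace ℝ ι) :
    ‖metricProj (ProperCone.innerDual (signDualCone σ) : Set (EuclideanSpace ℝ ι)) g‖ ^ 2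
      ≤ 4 / t ^ 2 * Real.exp (-t ^ 2) * ∑ i with σ i = 0, Real.cosh (t * g i)
        + ∑ i with σ i ≠ 0, (g i - σ i * t) ^ 2 := by
  set y : EuclideanSpace ℝ ι := WithLp.toLp 2 fun i =>
    if σ i = 0 then -max (-t) (min (g i) t) else -(σ i * t)
  have y_mem : y ∈ signDualCone σ := by
    refine ⟨t, ht.le, fun i hi => ?_, fun i hi => ?_⟩
    · simp only [y, hi, if_true, abs_neg]
      exact abs_le.2 ⟨le_max_left _ _, max_le (by linarith) (min_le_right _ _)⟩
    · have : (σ i : ℝ) * σ i = 1 := by rw [← sq, ← sq_abs, abs_signType_cast hi, one_pow]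
      simp only [y, hi, if_false]
      linear_combination (-t) * this
  refine (norm_sq_metricProj_innerDual_le y_mem g).trans ?_
  rw [EuclideanSpace.real_norm_sq_eq, ← Finset.sum_filter_add_sum_filter_not _ (σ · = 0),
    Finset.mul_sum]
  refine add_le_add (Finset.sum_le_sum fun i hi => ?_) (Finset.sum_le_sum fun i hi => ?_)
  · simpa [y, (Finset.mem_filter.1 hi).2, ← sub_eq_add_neg] using sq_sub_clip_le_cosh ht (g i)
  · simp [y, (Finset.mem_filter.1 hi).2, ← sub_eq_add_neg]

theorem integral_norm_sq_metricProj_innerDual_signDualCone_le (ht : 0 < t) :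
    ∫ g, ‖metricProj (ProperCone.innerDual (signDualCone σ) : Set (EuclideanSpace ℝ ι)) g‖ ^ 2
        ∂stdGaussian (EuclideanSpace ℝ ι)
      ≤ #{i | σ i = 0} * (4 / t ^ 2 * Real.exp (-(t ^ 2 / 2)))
        + #{i | σ i ≠ 0} * (1 + t ^ 2) := by
  have int_cosh : Integrable (fun g : EuclideanSpace ℝ ι => ∑ i with σ i = 0, Real.cosh (t * g i))
      (stdGaussian (EuclideanSpace ℝ ι)) :=
    integrable_finsetSum _ fun i _ =>
      integrable_comp_eval_stdGaussian (integrable_cosh_mul_gaussianReal t) i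
  have int_sq (i : ι) : Integrable (fun g : EuclideanSpace ℝ ι => (g i - σ i * t) ^ 2)
      (stdGaussian (EuclideanSpace ℝ ι)) :=
    integrable_comp_eval_stdGaussian (f := fun x => (x - σ i * t) ^ 2)
      (memLp_two_id_gaussianReal.sub (memLp_const _)).integrable_sq i
  have integral_sq (i : ι) (hi : σ i ≠ 0) :
      ∫ g, (g i - σ i * t) ^ 2 ∂stdGaussian (EuclideanSpace ℝ ι) = 1 + t ^ 2 := by
    rw [integral_comp_eval_stdGaussian (f := fun x => (x - σ i * t) ^ 2) (by fun_prop),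
      integral_sub_sq_gaussianReal, mul_pow, ← sq_abs (σ i : ℝ), abs_signType_cast hi, one_pow,
      one_mul]
  have exp_mul : Real.exp (-t ^ 2) * Real.exp (t ^ 2 / 2) = Real.exp (-(t ^ 2 / 2)) := by
    rw [← Real.exp_add]
    ring_nf
  refine (integral_mono (integrable_norm_sq_metricProj IsGaussian.memLp_two_id _)
    ((int_cosh.const_mul _).add (integrable_finsetSum _ fun i _ => int_sq i))
    (norm_sq_metricProj_innerDual_signDualCone_le σ ht)).trans_eq ?_
  rw [integral_add' (int_cosh.const_mul _) (integrable_finsetSum _ fun i _ => int_sq i),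
    integral_const_mul,
    integral_sum_comp_eval_stdGaussian _ (integrable_cosh_mul_gaussianReal t),
    integral_cosh_mul_gaussianReal, integral_finsetSum _ fun i _ => int_sq i,
    Finset.sum_congr rfl fun i hi => integral_sq i (Finset.mem_filter.1 hi).2, Finset.sum_const,
    nsmul_eq_mul, ← exp_mul]
  ring

end UpperBound

section LowerBound

open scoped Finset

variable {ι : Type*} [Fintype ι] (σ : ι → SignType) (t : ℝ)

/-- A direction in the dual of `signDualCone σ` that is strongly correlated with `g`: off the
support of `σ` its entries are `sinh (t * g j)`, and on the support the entries point against `σ`,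
the total size `∑ cosh (t * g j)` needed to dominate the former being shared equally. -/
noncomputable def sinhDescent (g : EuclideanSpace ℝ ι) : EuclideanSpace ℝ ι :=
  WithLp.toLp 2 fun i =>
    if σ i = 0 then Real.sinh (t * g i)
    else -(σ i / #{i | σ i ≠ 0} * ∑ j with σ j = 0, Real.cosh (t * g j))

theorem sum_comp_sinhDescent (φ : ι → ℝ → ℝ) (g : EuclideanSpace ℝ ι) :
    ∑ i, φ i (sinhDescent σ t g i) = ∑ i with σ i = 0, φ i (Real.sinh (t * g i))
      + ∑ i with σ i ≠ 0, φ i (-(σ i / #{i | σ i ≠ 0}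
        * ∑ j with σ j = 0, Real.cosh (t * g j))) := by
  rw [← Finset.sum_filter_add_sum_filter_not _ (σ · = 0)]
  congr 1 <;> refine Finset.sum_congr rfl fun i hi => ?_ <;>
    simp [sinhDescent, (Finset.mem_filter.1 hi).2]

variable {σ}

theorem sinhDescent_mem_innerDual (hσ : ∃ i, σ i ≠ 0) (g : EuclideanSpace ℝ ι) :
    sinhDescent σ t g ∈ ProperCone.innerDual (signDualCone σ) := by
  rw [ProperCone.mem_innerDual]
  rintro y ⟨r, hr, h_off, h_on⟩
  set V := ∑ j with σ j = 0, Real.cosh (t * g j)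
  set s := (#{i | σ i ≠ 0} : ℝ)
  have s_pos : 0 < s := by
    obtain ⟨i, hi⟩ := hσ
    exact Nat.cast_pos.2 (Finset.card_pos.2 ⟨i, by simpa using hi⟩)
  have V_nonneg : 0 ≤ V := Finset.sum_nonneg fun j _ => (Real.cosh_pos _).le
  have off_ge : -(r * V) ≤ ∑ i with σ i = 0, Real.sinh (t * g i) * y i := by
    rw [Finset.mul_sum, ← Finset.sum_neg_distrib]
    refine Finset.sum_le_sum fun i hi => neg_le_of_abs_le ?_
    rw [abs_mul, mul_comm]
    gcongr
    · exact h_off i (Finset.mem_filter.1 hi).2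
    · rw [Real.abs_sinh, ← Real.cosh_abs]
      exact (Real.sinh_lt_cosh _).le
  have on_ge : r * V ≤ ∑ i with σ i ≠ 0, -(σ i / s * V) * y i := by
    calc r * V = ∑ i with σ i ≠ 0, V / s * r := by
          rw [Finset.sum_const, nsmul_eq_mul]
          change _ = s * _
          field_simp
      _ ≤ ∑ i with σ i ≠ 0, V / s * -(σ i * y i) := by
          gcongr with i hi
          linarith [h_on i (Finset.mem_filter.1 hi).2]
      _ = _ := Finset.sum_congr rfl fun i _ => by ring
  have inner_eq : inner ℝ y (sinhDescent σ t g) = _ :=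
    (PiLp.inner_apply _ _).trans (sum_comp_sinhDescent σ t (fun i x => x * y i) g)
  linarith

theorem memLp_sinhDescent : MemLp (sinhDescent σ t) 2 (stdGaussian (EuclideanSpace ℝ ι)) := by
  refine MemLp.of_eval_piLp fun i => ?_
  by_cases hi : σ i = 0
  · simpa only [sinhDescent, hi, if_true] using
      memLp_comp_eval_stdGaussian (memLp_two_sinh_mul_gaussianReal t) i
  · simp only [sinhDescent, hi, if_false]
    exact ((memLp_finsetSum _ fun j _ =>
      memLp_comp_eval_stdGaussian (memLp_two_cosh_mul_gaussianReal t) j).const_mul _).neg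

theorem integral_inner_sinhDescent :
    ∫ g, inner ℝ g (sinhDescent σ t g) ∂stdGaussian (EuclideanSpace ℝ ι)
      = #{i | σ i = 0} * (t * Real.exp (t ^ 2 / 2)) := by
  have memLp_eval (i : ι) := memLp_comp_eval_stdGaussian memLp_two_id_gaussianReal i
  have memLp_cosh := memLp_two_cosh_mul_gaussianReal t
  have int_sinh : Integrable (fun x => x * Real.sinh (t * x)) (gaussianReal 0 1) :=
    memLp_two_id_gaussianReal.integrable_mul (memLp_two_sinh_mul_gaussianReal t)
  set c : ι → ℝ := fun i => -(σ i / #{i | σ i ≠ 0})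
  have inner_eq (g : EuclideanSpace ℝ ι) : inner ℝ g (sinhDescent σ t g)
      = ∑ i with σ i = 0, g i * Real.sinh (t * g i)
        + ∑ i with σ i ≠ 0, c i * (g i * ∑ j with σ j = 0, Real.cosh (t * g j)) := by
    rw [PiLp.inner_apply]
    refine (sum_comp_sinhDescent σ t (fun i x => x * g i) g).trans ?_
    congr 1 <;> refine Finset.sum_congr rfl fun i _ => ?_ <;> ring
  have int_cross (i : ι) : Integrable (fun g : EuclideanSpace ℝ ι =>
      c i * (g i * ∑ j with σ j = 0, Real.cosh (t * g j))) (stdGaussian (EuclideanSpace ℝ ι)) :=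
    ((memLp_eval i).integrable_mul (memLp_finsetSum _ fun j _ =>
      memLp_comp_eval_stdGaussian memLp_cosh j)).const_mul _
  simp_rw [inner_eq]
  rw [integral_add (integrable_finsetSum _ fun i _ => integrable_comp_eval_stdGaussian int_sinh i)
      (integrable_finsetSum _ fun i _ => int_cross i),
    integral_sum_comp_eval_stdGaussian (f := fun x => x * Real.sinh (t * x)) _ int_sinh,
    integral_mul_sinh_mul_gaussianReal, integral_finsetSum _ fun i _ => int_cross i,
    Finset.sum_eq_zero, add_zero]
  intro i hi
  rw [integral_const_mul, integral_mul_sum_comp_eval_stdGaussian _ memLp_cosh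
    (by simpa using hi), mul_zero]

theorem norm_sq_sinhDescent (g : EuclideanSpace ℝ ι) :
    ‖sinhDescent σ t g‖ ^ 2 = ∑ i with σ i = 0, Real.sinh (t * g i) ^ 2
      + (∑ j with σ j = 0, Real.cosh (t * g j)) ^ 2 / #{i | σ i ≠ 0} := by
  rw [EuclideanSpace.real_norm_sq_eq, sum_comp_sinhDescent σ t (fun _ x => x ^ 2)]
  set V := ∑ j with σ j = 0, Real.cosh (t * g j)
  set s := (#{i | σ i ≠ 0} : ℝ) with hs
  have sq_eq (i : ι) (hi : i ∈ Finset.univ.filter (σ · ≠ 0)) :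
      (-(σ i / s * V)) ^ 2 = V ^ 2 / s ^ 2 := by
    rw [neg_sq, mul_pow, div_pow, ← sq_abs (σ i : ℝ),
      abs_signType_cast (Finset.mem_filter.1 hi).2, one_pow]
    ring
  rw [Finset.sum_congr rfl sq_eq, Finset.sum_const, nsmul_eq_mul, ← hs]
  rcases eq_or_ne s 0 with h | h
  · simp [h]
  · field_simp

theorem integral_norm_sq_sinhDescent :
    ∫ g, ‖sinhDescent σ t g‖ ^ 2 ∂stdGaussian (EuclideanSpace ℝ ι)
      = #{i | σ i = 0} * ((Real.exp (2 * t ^ 2) - 1) / 2)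
        + (#{i | σ i = 0} * ((Real.exp (t ^ 2) - 1) ^ 2 / 2)
          + (#{i | σ i = 0} * Real.exp (t ^ 2 / 2)) ^ 2)
          / #{i | σ i ≠ 0} := by
  have memLp_cosh := memLp_two_cosh_mul_gaussianReal t
  have int_sinh_sq := (memLp_two_sinh_mul_gaussianReal t).integrable_sq
  have int_sum_sq : Integrable (fun g : EuclideanSpace ℝ ι =>
      (∑ j with σ j = 0, Real.cosh (t * g j)) ^ 2) (stdGaussian (EuclideanSpace ℝ ι)) :=
    (memLp_finsetSum _ fun j _ => memLp_comp_eval_stdGaussian memLp_cosh j).integrable_sq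
  simp_rw [norm_sq_sinhDescent]
  rw [integral_add (integrable_finsetSum _ fun i _ =>
      integrable_comp_eval_stdGaussian int_sinh_sq i) (int_sum_sq.div_const _),
    integral_div, integral_sum_comp_eval_stdGaussian (f := fun x => Real.sinh (t * x) ^ 2) _
      int_sinh_sq, integral_sinh_mul_sq_gaussianReal,
    integral_sq_sum_comp_eval_stdGaussian _ memLp_cosh, variance_cosh_mul_gaussianReal,
    integral_cosh_mul_gaussianReal]

theorem integral_norm_sq_sinhDescent_le (hσ : ∃ i, σ i ≠ 0) :
    ∫ g, ‖sinhDescent σ t g‖ ^ 2 ∂stdGaussian (EuclideanSpace ℝ ι)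
      ≤ #{i | σ i = 0} * Real.exp (t ^ 2)
        * (Real.exp (t ^ 2) + #{i | σ i = 0} / #{i | σ i ≠ 0}) := by
  have one_le_card : (1 : ℝ) ≤ #{i | σ i ≠ 0} := by
    obtain ⟨i, hi⟩ := hσ
    exact Nat.one_le_cast.2 (Finset.card_pos.2 ⟨i, by simpa using hi⟩)
  have one_le_exp : 1 ≤ Real.exp (t ^ 2) := Real.one_le_exp (sq_nonneg t)
  have exp_two_mul : Real.exp (2 * t ^ 2) = Real.exp (t ^ 2) ^ 2 := by
    rw [← Real.exp_nat_mul, Nat.cast_ofNat]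
  rw [integral_norm_sq_sinhDescent, mul_pow, Real.exp_half, Real.sq_sqrt (Real.exp_pos _).le,
    exp_two_mul, add_div]
  set n := (#{i | σ i = 0} : ℝ)
  set x := Real.exp (t ^ 2)
  have variance_le : n * ((x - 1) ^ 2 / 2) / #{i | σ i ≠ 0} ≤ n * (x ^ 2 / 2) := by
    refine (div_le_self (by positivity) one_le_card).trans ?_
    gcongr
    linarith
  have n_nonneg : 0 ≤ n := Nat.cast_nonneg _
  linear_combination variance_le + n_nonneg / 2

theorem card_mul_sq_le_integral_norm_sq_metricProj (hσ : ∃ i, σ i ≠ 0) (ht : 0 ≤ t) :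
    #{i | σ i = 0} * t ^ 2
      ≤ (∫ g, ‖metricProj (ProperCone.innerDual (signDualCone σ) : Set (EuclideanSpace ℝ ι)) g‖ ^ 2
          ∂stdGaussian (EuclideanSpace ℝ ι))
        * (Real.exp (t ^ 2) + #{i | σ i = 0} / #{i | σ i ≠ 0}) := by
  have cauchy_schwarz := sq_integral_inner_le (μ := stdGaussian (EuclideanSpace ℝ ι))
    IsGaussian.memLp_two_id (sinhDescent_mem_innerDual t hσ) (memLp_sinhDescent t)
    (by rw [integral_inner_sinhDescent]; positivity)
  rw [integral_inner_sinhDescent] at cauchy_schwarz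
  set D := ∫ g,
    ‖metricProj (ProperCone.innerDual (signDualCone σ) : Set (EuclideanSpace ℝ ι)) g‖ ^ 2
      ∂stdGaussian (EuclideanSpace ℝ ι)
  have D_nonneg : 0 ≤ D := integral_nonneg fun g => by positivity
  have bound := cauchy_schwarz.trans
    (mul_le_mul_of_nonneg_left (integral_norm_sq_sinhDescent_le t hσ) D_nonneg)
  rw [mul_pow, mul_pow, Real.exp_half, Real.sq_sqrt (Real.exp_pos _).le] at bound
  rcases Nat.eq_zero_or_pos #{i | σ i = 0} with h | h
  · simpa [h] using mul_nonneg D_nonneg (Real.exp_pos _).le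
  · refine le_of_mul_le_mul_left ?_ (by positivity : 0 < #{i | σ i = 0} * Real.exp (t ^ 2))
    linarith

end LowerBound

section StatDimKappaNorm

open scoped Finset

variable {k p : ℕ} {a : EuclideanSpace ℝ (Fin p)}

theorem card_sign_ne_zero_of_mem_cutAtoms (ha : a ∈ cutAtoms k p) :
    #{i | SignType.sign (a i) ≠ 0} = k := by
  simpa only [ne_eq, sign_eq_zero_iff] using card_support_of_mem_cutAtoms ha

theorem card_sign_eq_zero_of_mem_cutAtoms (ha : a ∈ cutAtoms k p) :
    (#{i | SignType.sign (a i) = 0} : ℝ) = p - k := by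
  have h := Finset.card_filter_add_card_filter_not (s := Finset.univ)
    (fun i => SignType.sign (a i) = 0)
  rw [card_sign_ne_zero_of_mem_cutAtoms ha, Finset.card_univ, Fintype.card_fin] at h
  rw [eq_sub_iff_add_eq]
  exact_mod_cast h

theorem le_of_mem_cutAtoms (ha : a ∈ cutAtoms k p) : k ≤ p := by
  simpa [card_support_of_mem_cutAtoms ha] using (Finset.univ.filter (a · ≠ 0)).card_le_univ

theorem log_div_nonneg_of_mem_cutAtoms (hk : k ≠ 0) (ha : a ∈ cutAtoms k p) :
    0 ≤ Real.log (p / k : ℝ) := by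
  have : 0 < (k : ℝ) := by positivity
  exact Real.log_nonneg ((one_le_div this).2 (Nat.cast_le.2 (le_of_mem_cutAtoms ha)))

theorem integrable_norm_sq_metricProj_descentTangentCone (hk : k ≠ 0) (ha : a ∈ cutAtoms k p) :
    Integrable (fun g => ‖metricProj (descentTangentCone (kappaNorm k p) a) g‖ ^ 2)
      (stdGaussian (EuclideanSpace ℝ (Fin p))) := by
  rw [descentTangentCone_kappaNorm hk ha]
  exact integrable_norm_sq_metricProj IsGaussian.memLp_two_id _

theorem statDim_kappaNorm (hk : k ≠ 0) (ha : a ∈ cutAtoms k p) :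
    statDim a (kappaNorm k p) = ∫ g, ‖metricProj (ProperCone.innerDual
        (signDualCone fun i => SignType.sign (a i)) : Set (EuclideanSpace ℝ (Fin p))) g‖ ^ 2
      ∂stdGaussian (EuclideanSpace ℝ (Fin p)) := by
  rw [statDim, descentTangentCone_kappaNorm hk ha]

theorem statDim_nonneg {E : Type*} [NormedAddCommGroup E] [InnerProductSpace ℝ E]
    [FiniteDimensional ℝ E] [MeasurableSpace E] [BorelSpace E] (z : E) (Ω : E → ℝ) :
    0 ≤ statDim z Ω :=
  integral_nonneg fun _ => sq_nonneg _

theorem statDim_kappaNorm_le (hk : k ≠ 0) (ha : a ∈ cutAtoms k p) :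
    statDim a (kappaNorm k p) ≤ 2 * k * Real.log (p / k) + 6 * k := by
  have k_pos : 0 < (k : ℝ) := by positivity
  have k_le_p : (k : ℝ) ≤ p := Nat.cast_le.2 (le_of_mem_cutAtoms ha)
  set L := Real.log (p / k) with hL
  have L_nonneg : 0 ≤ L := log_div_nonneg_of_mem_cutAtoms hk ha
  have t_sq : √(2 * L + 4) ^ 2 = 2 * L + 4 := Real.sq_sqrt (by positivity)
  have off_support_le :
      (p - k : ℝ) * (4 / (2 * L + 4) * Real.exp (-((2 * L + 4) / 2))) ≤ k := by
    calc (p - k : ℝ) * (4 / (2 * L + 4) * Real.exp (-((2 * L + 4) / 2)))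
        ≤ p * (1 * Real.exp (-L)) := by
          gcongr
          · linarith
          · exact (div_le_one (by positivity)).2 (by linarith)
          · linarith
      _ = k := by
          have p_pos : 0 < (p : ℝ) := k_pos.trans_le k_le_p
          rw [hL, Real.exp_neg, Real.exp_log (by positivity)]
          field_simp
  have h := integral_norm_sq_metricProj_innerDual_signDualCone_le
    (fun i => SignType.sign (a i)) (t := √(2 * L + 4)) (by positivity)
  rw [← statDim_kappaNorm hk ha, card_sign_eq_zero_of_mem_cutAtoms ha,
    card_sign_ne_zero_of_mem_cutAtoms ha, t_sq] at h
  linarith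

theorem le_statDim_kappaNorm (hk : k ≠ 0) (ha : a ∈ cutAtoms k p) :
    k / 2 * Real.log ((p - k) / (k + 1)) ≤ statDim a (kappaNorm k p) := by
  have D_nonneg := statDim_nonneg a (kappaNorm k p)
  have k_le_p : (k : ℝ) ≤ p := Nat.cast_le.2 (le_of_mem_cutAtoms ha)
  set r : ℝ := (p - k) / (k + 1) with hr
  rcases le_or_gt (Real.log r) 0 with h_log | h_log
  · exact (mul_nonpos_of_nonneg_of_nonpos (by positivity) h_log).trans D_nonneg
  have r_pos : 0 < r := by
    refine lt_of_le_of_ne (div_nonneg (sub_nonneg.2 k_le_p) (by positivity)) fun h => ?_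
    simp [← h] at h_log
  have h := card_mul_sq_le_integral_norm_sq_metricProj (σ := fun i => SignType.sign (a i))
    (t := √(Real.log r))
    ((exists_ne_zero_of_mem_cutAtoms hk ha).imp fun i => sign_ne_zero.2) (by positivity)
  have sub_eq : (p - k : ℝ) = (k + 1) * r := by rw [hr]; field_simp
  rw [← statDim_kappaNorm hk ha, card_sign_eq_zero_of_mem_cutAtoms ha,
    card_sign_ne_zero_of_mem_cutAtoms ha, Real.sq_sqrt h_log.le, Real.exp_log r_pos, sub_eq] at h
  have cancelled : (k + 1) * (k * Real.log r) ≤ statDim a (kappaNorm k p) * (2 * k + 1) := by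
    refine le_of_mul_le_mul_left ?_ (by positivity : 0 < r / k)
    convert! h using 1 <;> field_simp
    ring
  refine le_of_mul_le_mul_left ?_ (by positivity : 0 < 2 * (k + 1 : ℝ))
  linarith

end StatDimKappaNorm

theorem mainTheorem10 (k p : ℕ) (hk : 1 ≤ k) (a : EuclideanSpace ℝ (Fin p))
    (ha : a ∈ cutAtoms k p) :
    Integrable (fun g => ‖metricProj (descentTangentCone (kappaNorm k p) a) g‖ ^ 2)
        (stdGaussian (EuclideanSpace ℝ (Fin p))) ∧
      (k : ℝ) / (2 * Real.pi) * Real.log (((p : ℝ) - k) / (k + 1)) ≤ statDim a (kappaNorm k p) ∧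
      statDim a (kappaNorm k p) ≤ 9 * k * Real.log ((p : ℝ) / k) + 16 * (k + 1) := by
  have hk : k ≠ 0 := Nat.one_le_iff_ne_zero.1 hk
  refine ⟨integrable_norm_sq_metricProj_descentTangentCone hk ha, ?_, ?_⟩
  · calc (k : ℝ) / (2 * Real.pi) * Real.log ((p - k) / (k + 1))
        = k / 2 * Real.log ((p - k) / (k + 1)) / Real.pi := by ring
      _ ≤ statDim a (kappaNorm k p) / Real.pi := by
          gcongr
          exact le_statDim_kappaNorm hk ha
      _ ≤ statDim a (kappaNorm k p) :=
          div_le_self (statDim_nonneg _ _) (by linarith [Real.pi_gt_three])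
  · have log_nonneg := mul_nonneg k.cast_nonneg (log_div_nonneg_of_mem_cutAtoms hk ha)
    linarith [statDim_kappaNorm_le hk ha, (k.cast_nonneg : (0 : ℝ) ≤ k)]
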